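/- Let $K$ be an infinite field. For a finite graph $F=(F^0,F^1,r,s)$ let $L(F)=L_K(F)$ be its Leavitt path algebra: the $K$-algebra generated by pairwise orthogonal idempotents $v\in F^0$ and elements $e,e^*$ ($e\in F^1$) subject to $s(e)e=er(e)=e$, $r(e)e^*=e^*s(e)=e^*$, $e^*e'=\delta_{e,e'}r(e)$, and $v=\sum_{s(e)=v}ee^*$ for every vertex $v$ that is not a sink; its unit is $\sum_{v\in F^0}v$. Its degree zero subalgebra $L(F)_0$ is the linear span of the elements $pq^*$ with $p,q$ paths of the same length (vertices being the paths of length $0$). For a unital $K$-algebra $A$ and a $K$-algebra isomorphism $\beta$ from $A$ onto a corner $pAp$ ($p=p^2\in A$), let $A[t_+,t_-;\beta]$ be the $K$-algebra generated by $A$ and two elements $t_+,t_-$ subject to $t_-t_+=1$, $t_+t_-=p$, and $t_+^na=\beta^n(a)t_+^n$, $at_-^n=t_-^n\beta^n(a)$ for all $a\in A$, $n\ge 0$. An automorphism $g$ of $A$ is called locally inner if for any $x_1,\dots,x_n\in A$ there is an inner automorphism $h$ of $A$ with $h(x_i)=g(x_i)$ for $i=1,\dots,n$. Let $E$ be the graph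 with adjacency matrix $\begin{pmatrix}1&0\\1&1\end{pmatrix}^{t}$, that is, with vertices $v,w$ and edges $e,f,\gamma$, where $s(e)=r(e)=s(f)=v$ and $r(f)=s(\gamma)=r(\gamma)=w$. In $L(E)$ put $t_+=e+\gamma$, $t_-=e^*+\gamma^*$, and let $\alpha(x)=t_+xt_-$ for $x\in L(E)_0$, the corner isomorphism of $L(E)_0$ onto $pL(E)_0p$ with $p=t_+t_-$. For an automorphism $g$ of $L(E)_0$ put $L^g(E)=L(E)_0[s_+,s_-;g\circ\alpha]$, with new generators $s_+,s_-$ in the roles of $t_+,t_-$ above. Then there is a locally inner automorphism $g$ of $L(E)_0$ such that $L^g(E)$ is not finitely generated as a $K$-algebra and, consequently, $L^g(E)$ is not isomorphic as a $K$-algebra to $L(F)$ for any finite graph $F$. -/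

import Mathlib

universe u v w

/-- A (directed) graph: vertices, edges, a source map and a range map. -/
structure DirectedGraph where
  E0 : Type u
  E1 : Type v
  s : E1 → E0
  r : E1 → E0

namespace DirectedGraph

/-- Entry `(i, j)` is the number of edges with source `i` and range `j`. -/
noncomputable def adjMatrix (E : DirectedGraph.{u, v}) : Matrix E.E0 E.E0 ℕ :=
  fun i j => Nat.card {e : E.E1 // E.s e = i ∧ E.r e = j}

/-- `Path E a b n`: the paths of length `n` from `a` to `b`.
The paths of length zero are the vertices. -/
inductive Path (E : DirectedGraph.{u, v}) : E.E0 → E.E0 → ℕ → Type (max u v)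
  | nil (a : E.E0) : Path E a a 0
  | cons (e : E.E1) {b : E.E0} {n : ℕ} (p : Path E (E.r e) b n) : Path E (E.s e) b (n + 1)

/-- The symbols `v`, `e`, `e*` generating the Leavitt path algebra. -/
inductive Gen (E : DirectedGraph.{u, v}) : Type (max u v)
  | vertex (a : E.E0) : Gen E
  | edge (e : E.E1) : Gen E
  | ghost (e : E.E1) : Gen E

section Leavitt

variable (K : Type w) [Field K] (E : DirectedGraph.{u, v})

open Classical in
/-- The defining relations of the Leavitt path algebra of a finite graph. For a finite graph the
sum of all vertices is the unit of the algebra; `sum_vertex` records it, so that the unital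
presentation below gives the usual algebra. -/
inductive LeavittRel [Fintype E.E0] [Fintype E.E1] :
    FreeAlgebra K (Gen E) → FreeAlgebra K (Gen E) → Prop
  | vertex_idem (a : E.E0) :
      LeavittRel (FreeAlgebra.ι K (.vertex a) * FreeAlgebra.ι K (.vertex a))
        (FreeAlgebra.ι K (.vertex a))
  | vertex_orth (a b : E.E0) (h : a ≠ b) :
      LeavittRel (FreeAlgebra.ι K (.vertex a) * FreeAlgebra.ι K (.vertex b)) 0
  | source_edge (e : E.E1) :
      LeavittRel (FreeAlgebra.ι K (.vertex (E.s e)) * FreeAlgebra.ι K (.edge e))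
        (FreeAlgebra.ι K (.edge e))
  | edge_range (e : E.E1) :
      LeavittRel (FreeAlgebra.ι K (.edge e) * FreeAlgebra.ι K (.vertex (E.r e)))
        (FreeAlgebra.ι K (.edge e))
  | range_ghost (e : E.E1) :
      LeavittRel (FreeAlgebra.ι K (.vertex (E.r e)) * FreeAlgebra.ι K (.ghost e))
        (FreeAlgebra.ι K (.ghost e))
  | ghost_source (e : E.E1) :
      LeavittRel (FreeAlgebra.ι K (.ghost e) * FreeAlgebra.ι K (.vertex (E.s e)))
        (FreeAlgebra.ι K (.ghost e))
  | ck1_same (e : E.E1) :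
      LeavittRel (FreeAlgebra.ι K (.ghost e) * FreeAlgebra.ι K (.edge e))
        (FreeAlgebra.ι K (.vertex (E.r e)))
  | ck1_distinct (e f : E.E1) (h : e ≠ f) :
      LeavittRel (FreeAlgebra.ι K (.ghost e) * FreeAlgebra.ι K (.edge f)) 0
  | ck2 (a : E.E0) (h : ∃ e, E.s e = a) :
      LeavittRel (FreeAlgebra.ι K (.vertex a))
        (∑ e ∈ Finset.univ.filter (fun e : E.E1 => E.s e = a),
          FreeAlgebra.ι K (.edge e) * FreeAlgebra.ι K (.ghost e))
  | sum_vertex : LeavittRel (∑ a : E.E0, FreeAlgebra.ι K (.vertex a)) 1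

variable [Fintype E.E0] [Fintype E.E1]

/-- The Leavitt path algebra `L_K(E)` of a finite graph `E`. -/
abbrev LPA : Type (max u v w) := RingQuot (LeavittRel K E)

namespace LPA

/-- The vertex `a` as an element of `L_K(E)`. -/
noncomputable def vertex (a : E.E0) : LPA K E :=
  RingQuot.mkAlgHom K (LeavittRel K E) (FreeAlgebra.ι K (.vertex a))

/-- The edge `e` as an element of `L_K(E)`. -/
noncomputable def edge (e : E.E1) : LPA K E :=
  RingQuot.mkAlgHom K (LeavittRel K E) (FreeAlgebra.ι K (.edge e))

/-- The element `e*` of `L_K(E)`. -/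
noncomputable def ghost (e : E.E1) : LPA K E :=
  RingQuot.mkAlgHom K (LeavittRel K E) (FreeAlgebra.ι K (.ghost e))

/-- The path `p` as an element of `L_K(E)`. -/
noncomputable def ofPath : {a b : E.E0} → {n : ℕ} → Path E a b n → LPA K E
  | _, _, _, .nil a => vertex K E a
  | _, _, _, .cons e p => edge K E e * ofPath p

/-- The element `p*` of `L_K(E)`. -/
noncomputable def ofPathStar : {a b : E.E0} → {n : ℕ} → Path E a b n → LPA K E
  | _, _, _, .nil a => vertex K E a
  | _, _, _, .cons e p => ofPathStar p * ghost K E e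

theorem vertex_idem (a : E.E0) : vertex K E a * vertex K E a = vertex K E a := by
  simpa [vertex] using RingQuot.mkAlgHom_rel K (LeavittRel.vertex_idem (K := K) a)

theorem vertex_orth {a b : E.E0} (h : a ≠ b) : vertex K E a * vertex K E b = 0 := by
  simpa [vertex] using RingQuot.mkAlgHom_rel K (LeavittRel.vertex_orth (K := K) a b h)

theorem source_edge (e : E.E1) : vertex K E (E.s e) * edge K E e = edge K E e := by
  simpa [vertex, edge] using RingQuot.mkAlgHom_rel K (LeavittRel.source_edge (K := K) e)

theorem edge_range (e : E.E1) : edge K E e * vertex K E (E.r e) = edge K E e := by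
  simpa [vertex, edge] using RingQuot.mkAlgHom_rel K (LeavittRel.edge_range (K := K) e)

theorem range_ghost (e : E.E1) : vertex K E (E.r e) * ghost K E e = ghost K E e := by
  simpa [vertex, ghost] using RingQuot.mkAlgHom_rel K (LeavittRel.range_ghost (K := K) e)

theorem ghost_source (e : E.E1) : ghost K E e * vertex K E (E.s e) = ghost K E e := by
  simpa [vertex, ghost] using RingQuot.mkAlgHom_rel K (LeavittRel.ghost_source (K := K) e)

theorem ck1_same (e : E.E1) : ghost K E e * edge K E e = vertex K E (E.r e) := by
  simpa [vertex, edge, ghost] using RingQuot.mkAlgHom_rel K (LeavittRel.ck1_same (K := K) e)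

theorem ck1_distinct {e f : E.E1} (h : e ≠ f) : ghost K E e * edge K E f = 0 := by
  simpa [edge, ghost] using RingQuot.mkAlgHom_rel K (LeavittRel.ck1_distinct (K := K) e f h)

theorem sum_vertex : ∑ a : E.E0, vertex K E a = 1 := by
  simpa [vertex] using RingQuot.mkAlgHom_rel K (LeavittRel.sum_vertex (K := K) (E := E))

theorem vertex_mul_ofPath {a b : E.E0} {n : ℕ} (p : Path E a b n) :
    vertex K E a * ofPath K E p = ofPath K E p := by
  cases p with
  | nil => exact vertex_idem K E _
  | cons e p => rw [ofPath, ← mul_assoc, source_edge]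

theorem vertex_mul_ofPath_ne {a b c : E.E0} (h : c ≠ a) {n : ℕ} (p : Path E a b n) :
    vertex K E c * ofPath K E p = 0 := by
  rw [← vertex_mul_ofPath, ← mul_assoc, vertex_orth K E h, zero_mul]

theorem ofPathStar_mul_vertex {a b : E.E0} {n : ℕ} (p : Path E a b n) :
    ofPathStar K E p * vertex K E a = ofPathStar K E p := by
  cases p with
  | nil => exact vertex_idem K E _
  | cons e p => rw [ofPathStar, mul_assoc, ghost_source]

theorem ofPathStar_mul_vertex_ne {a b c : E.E0} (h : a ≠ c) {n : ℕ} (p : Path E a b n) :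
    ofPathStar K E p * vertex K E c = 0 := by
  rw [← ofPathStar_mul_vertex, mul_assoc, vertex_orth K E h, mul_zero]

theorem exists_comp {a b c : E.E0} {m n : ℕ} (p : Path E a b m) (q : Path E b c n) :
    ∃ t : Path E a c (m + n), ofPath K E t = ofPath K E p * ofPath K E q ∧
      ofPathStar K E t = ofPathStar K E q * ofPathStar K E p := by
  induction p with
  | nil a =>
    rw [Nat.zero_add]
    exact ⟨q, (vertex_mul_ofPath K E q).symm, (ofPathStar_mul_vertex K E q).symm⟩
  | cons e p ih =>
    obtain ⟨t, h1, h2⟩ := ih q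
    rw [Nat.add_right_comm]
    exact ⟨.cons e t, by rw [ofPath, ofPath, h1, mul_assoc],
      by rw [ofPathStar, ofPathStar, h2, mul_assoc]⟩

theorem ofPathStar_mul_ofPath {a b c d : E.E0} {m n : ℕ} (q : Path E a b m) (p : Path E c d n) :
    ofPathStar K E q * ofPath K E p = 0 ∨
      (∃ (k : ℕ) (t : Path E b d k), m + k = n ∧
        ofPathStar K E q * ofPath K E p = ofPath K E t) ∨
      (∃ (k : ℕ) (t : Path E d b k), n + k = m ∧
        ofPathStar K E q * ofPath K E p = ofPathStar K E t) := by
  classical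
  induction q generalizing c n with
  | nil a =>
    by_cases h : a = c
    · subst h
      exact .inr (.inl ⟨n, p, Nat.zero_add n, vertex_mul_ofPath K E p⟩)
    · exact .inl (vertex_mul_ofPath_ne K E h p)
  | @cons e b m q ih =>
    cases p with
    | nil =>
      by_cases h : E.s e = d
      · subst h
        exact .inr (.inr ⟨m + 1, .cons e q, Nat.zero_add _,
          ofPathStar_mul_vertex K E (.cons e q)⟩)
      · exact .inl (ofPathStar_mul_vertex_ne K E h (.cons e q))
    | @cons f _ n p =>
      have key : ofPathStar K E (.cons e q) * ofPath K E (.cons f p) =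
          ofPathStar K E q * (ghost K E e * edge K E f) * ofPath K E p := by
        rw [ofPathStar, ofPath]; simp only [mul_assoc]
      by_cases h : e = f
      · subst h
        rw [key, ck1_same, ofPathStar_mul_vertex]
        rcases ih p with h0 | ⟨k, t, hk, ht⟩ | ⟨k, t, hk, ht⟩
        · exact .inl h0
        · exact .inr (.inl ⟨k, t, by omega, ht⟩)
        · exact .inr (.inr ⟨k, t, by omega, ht⟩)
      · left
        rw [key, ck1_distinct K E h, mul_zero, zero_mul]

/-- The homogeneous component of degree `d` in the canonical `ℤ`-grading of `L_K(E)`: the span of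
the elements `p q*` with `length p - length q = d`. (For paths with distinct ranges `p q* = 0`.) -/
def degreeComponent (d : ℤ) : Submodule K (LPA K E) :=
  Submodule.span K {x | ∃ (a b c : E.E0) (m n : ℕ) (p : Path E a c m) (q : Path E b c n),
    (m : ℤ) - n = d ∧ x = ofPath K E p * ofPathStar K E q}

theorem monomial_mul_monomial {a b c a' b' c' : E.E0} {n n' : ℕ}
    (p : Path E a c n) (q : Path E b c n) (p' : Path E a' c' n') (q' : Path E b' c' n') :
    ofPath K E p * ofPathStar K E q * (ofPath K E p' * ofPathStar K E q') ∈
      degreeComponent K E 0 := by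
  have key : ofPath K E p * ofPathStar K E q * (ofPath K E p' * ofPathStar K E q') =
      ofPath K E p * (ofPathStar K E q * ofPath K E p') * ofPathStar K E q' := by
    simp only [mul_assoc]
  rw [key]
  rcases ofPathStar_mul_ofPath K E q p' with h | ⟨k, t, hk, h⟩ | ⟨k, t, hk, h⟩
  · rw [h, mul_zero, zero_mul]; exact Submodule.zero_mem _
  · obtain ⟨t', h1, -⟩ := exists_comp K E p t
    rw [h, ← h1]
    exact Submodule.subset_span ⟨_, _, _, _, _, t', q', by omega, rfl⟩
  · obtain ⟨t', -, h2⟩ := exists_comp K E q' t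
    rw [h, mul_assoc, ← h2]
    exact Submodule.subset_span ⟨_, _, _, _, _, p, t', by omega, rfl⟩

theorem degreeComponent_zero_mul {x y : LPA K E} (hx : x ∈ degreeComponent K E 0)
    (hy : y ∈ degreeComponent K E 0) : x * y ∈ degreeComponent K E 0 := by
  induction hx, hy using Submodule.span_induction₂ with
  | mem_mem x y hx hy =>
    obtain ⟨a, b, c, m, n, p, q, h, rfl⟩ := hx
    obtain ⟨a', b', c', m', n', p', q', h', rfl⟩ := hy
    obtain rfl : m = n := by omega
    obtain rfl : m' = n' := by omega
    exact monomial_mul_monomial K E p q p' q'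
  | zero_left y hy => rw [zero_mul]; exact Submodule.zero_mem _
  | zero_right x hx => rw [mul_zero]; exact Submodule.zero_mem _
  | add_left x y z _ _ _ h1 h2 => rw [add_mul]; exact Submodule.add_mem _ h1 h2
  | add_right x y z _ _ _ h1 h2 => rw [mul_add]; exact Submodule.add_mem _ h1 h2
  | smul_left r x y _ _ h => rw [smul_mul_assoc]; exact Submodule.smul_mem _ _ h
  | smul_right r x y _ _ h => rw [mul_smul_comm]; exact Submodule.smul_mem _ _ h

theorem one_mem_degreeComponent : (1 : LPA K E) ∈ degreeComponent K E 0 := by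
  rw [← sum_vertex]
  refine Submodule.sum_mem _ fun a _ => Submodule.subset_span
    ⟨a, a, a, 0, 0, .nil a, .nil a, by simp, ?_⟩
  exact (vertex_idem K E a).symm

/-- The degree zero subalgebra `L_K(E)_0`. -/
def zeroComponent : Subalgebra K (LPA K E) where
  carrier := degreeComponent K E 0
  mul_mem' := degreeComponent_zero_mul K E
  add_mem' := Submodule.add_mem _
  algebraMap_mem' c := by
    rw [Algebra.algebraMap_eq_smul_one]
    exact Submodule.smul_mem _ _ (one_mem_degreeComponent K E)

/-- `t₊ = ∑ e_a`, for a choice `c` of one edge `e_a = c a` ending at each vertex `a`. -/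
noncomputable def tPlus (c : E.E0 → E.E1) : LPA K E := ∑ a, edge K E (c a)

/-- `t₋ = ∑ e_a*`, for a choice `c` of one edge `e_a = c a` ending at each vertex `a`. -/
noncomputable def tMinus (c : E.E0 → E.E1) : LPA K E := ∑ a, ghost K E (c a)


theorem tMinus_mul_tPlus {c : E.E0 → E.E1} (hc : ∀ a, E.r (c a) = a) : tMinus K E c * tPlus K E c = 1 := by
  classical
  rw [tMinus, tPlus, Finset.sum_mul_sum, ← sum_vertex]
  refine Finset.sum_congr rfl fun a _ => ?_
  rw [Finset.sum_eq_single a, ck1_same, hc]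
  · intro b _ hb
    refine ck1_distinct K E fun h => hb ?_
    rw [← hc b, ← h, hc]
  · simp

theorem edge_mul_ofPath_ne {e : E.E1} {a b : E.E0} (h : E.r e ≠ a) {n : ℕ} (p : Path E a b n) :
    edge K E e * ofPath K E p = 0 := by
  rw [← edge_range, mul_assoc, vertex_mul_ofPath_ne K E h, mul_zero]

theorem ofPathStar_mul_ghost_ne {e : E.E1} {a b : E.E0} (h : E.r e ≠ a) {n : ℕ}
    (p : Path E a b n) : ofPathStar K E p * ghost K E e = 0 := by
  rw [← range_ghost, ← mul_assoc, ofPathStar_mul_vertex_ne K E h.symm, zero_mul]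

theorem exists_tPlus_mul_ofPath {c : E.E0 → E.E1} (hc : ∀ a, E.r (c a) = a) {a b : E.E0} {n : ℕ}
    (p : Path E a b n) :
    ∃ (a' : E.E0) (t : Path E a' b (n + 1)), tPlus K E c * ofPath K E p = ofPath K E t ∧
      ofPathStar K E p * tMinus K E c = ofPathStar K E t := by
  classical
  have h1 : tPlus K E c * ofPath K E p = edge K E (c a) * ofPath K E p := by
    rw [tPlus, Finset.sum_mul, Finset.sum_eq_single a]
    · intro b _ hb
      exact edge_mul_ofPath_ne K E (by rwa [hc]) p
    · simp
  have h2 : ofPathStar K E p * tMinus K E c = ofPathStar K E p * ghost K E (c a) := by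
    rw [tMinus, Finset.mul_sum, Finset.sum_eq_single a]
    · intro b _ hb
      exact ofPathStar_mul_ghost_ne K E (by rwa [hc]) p
    · simp
  rw [h1, h2]
  obtain ⟨e, rfl⟩ : ∃ e, E.r e = a := ⟨c a, hc a⟩
  generalize he : c (E.r e) = f
  have hf : E.r f = E.r e := by rw [← he, hc]
  revert p
  rw [← hf]
  intro p _ _
  exact ⟨_, .cons f p, rfl, rfl⟩

theorem tPlus_mul_mul_tMinus_mem {c : E.E0 → E.E1} (hc : ∀ a, E.r (c a) = a) 
    {x : LPA K E} (hx : x ∈ zeroComponent K E) : tPlus K E c * x * tMinus K E c ∈ zeroComponent K E := by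
  change _ ∈ degreeComponent K E 0
  change _ ∈ degreeComponent K E 0 at hx
  induction hx using Submodule.span_induction with
  | mem x hx =>
    obtain ⟨a, b, d, m, n, p, q, h, rfl⟩ := hx
    obtain ⟨a', t, h1, -⟩ := exists_tPlus_mul_ofPath K E hc p
    obtain ⟨b', t', -, h2⟩ := exists_tPlus_mul_ofPath K E hc q
    refine Submodule.subset_span ⟨a', b', d, m + 1, n + 1, t, t', by push_cast; omega, ?_⟩
    rw [← h1, ← h2]
    simp only [mul_assoc]
  | zero => rw [mul_zero, zero_mul]; exact Submodule.zero_mem _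
  | add x y _ _ h1 h2 => rw [mul_add, add_mul]; exact Submodule.add_mem _ h1 h2
  | smul r x _ h => rw [mul_smul_comm, smul_mul_assoc]; exact Submodule.smul_mem _ _ h

/-- The corner map `α(x) = t₊ x t₋` of `L_K(E)_0`. It is a multiplicative `K`-linear map; its
value at `1` is the idempotent `t₊ t₋`. -/
noncomputable def cornerMap (c : E.E0 → E.E1) (hc : ∀ a, E.r (c a) = a) :
    zeroComponent K E →ₙₐ[K] zeroComponent K E where
  toFun x := ⟨tPlus K E c * x * tMinus K E c, tPlus_mul_mul_tMinus_mem K E hc x.2⟩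
  map_smul' r x := by
    apply Subtype.ext
    simp
  map_zero' := by
    apply Subtype.ext
    simp
  map_add' x y := by
    apply Subtype.ext
    simp [mul_add, add_mul]
  map_mul' x y := by
    apply Subtype.ext
    change tPlus K E c * ((x : LPA K E) * y) * tMinus K E c =
      tPlus K E c * x * tMinus K E c * (tPlus K E c * y * tMinus K E c)
    calc _ = tPlus K E c * x * 1 * y * tMinus K E c := by simp only [mul_assoc, one_mul]
      _ = _ := by rw [← tMinus_mul_tPlus K E hc]; simp only [mul_assoc]

end LPA

end Leavitt

end DirectedGraph

section Skew

variable (K : Type w) [Field K] {A : Type u} [Semiring A] [Algebra K A]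

/-- The symbols generating `A[t₊, t₋; α]`: the elements of `A` and `t₊`, `t₋`. -/
inductive SkewGen (A : Type u) : Type u
  | of (a : A) : SkewGen A
  | tPlus : SkewGen A
  | tMinus : SkewGen A

/-- The defining relations of `A[t₊, t₋; α]`, with `p = α(1)`. The first five say that `A` maps to
the quotient by a homomorphism of unital `K`-algebras. -/
inductive SkewRel (α : A →ₙₐ[K] A) :
    FreeAlgebra K (SkewGen A) → FreeAlgebra K (SkewGen A) → Prop
  | of_add (a b : A) : SkewRel α (FreeAlgebra.ι K (.of (a + b)))
      (FreeAlgebra.ι K (.of a) + FreeAlgebra.ι K (.of b))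
  | of_mul (a b : A) : SkewRel α (FreeAlgebra.ι K (.of (a * b)))
      (FreeAlgebra.ι K (.of a) * FreeAlgebra.ι K (.of b))
  | of_smul (k : K) (a : A) : SkewRel α (FreeAlgebra.ι K (.of (k • a)))
      (k • FreeAlgebra.ι K (.of a))
  | of_zero : SkewRel α (FreeAlgebra.ι K (.of (0 : A))) 0
  | of_one : SkewRel α (FreeAlgebra.ι K (.of (1 : A))) 1
  | tMinus_tPlus : SkewRel α (FreeAlgebra.ι K .tMinus * FreeAlgebra.ι K .tPlus) 1
  | tPlus_tMinus : SkewRel α (FreeAlgebra.ι K .tPlus * FreeAlgebra.ι K .tMinus)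
      (FreeAlgebra.ι K (.of (α 1)))
  | tPlus_of (n : ℕ) (a : A) : SkewRel α
      (FreeAlgebra.ι K .tPlus ^ n * FreeAlgebra.ι K (.of a))
      (FreeAlgebra.ι K (.of (α^[n] a)) * FreeAlgebra.ι K .tPlus ^ n)
  | of_tMinus (n : ℕ) (a : A) : SkewRel α
      (FreeAlgebra.ι K (.of a) * FreeAlgebra.ι K .tMinus ^ n)
      (FreeAlgebra.ι K .tMinus ^ n * FreeAlgebra.ι K (.of (α^[n] a)))

/-- The fractional skew monoid ring `A[t₊, t₋; α]` of `A` over `ℤ⁺`, for a multiplicative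
`K`-linear map `α : A → A` (an isomorphism onto the corner `pAp`, `p = α(1)`, where it is used). -/
abbrev SkewMonoidRing (α : A →ₙₐ[K] A) : Type (max u w) := RingQuot (SkewRel K α)

/-- An automorphism of an algebra is locally inner if on each finite set of elements it agrees
with some inner automorphism. -/
def IsLocallyInner {K : Type w} [Field K] {A : Type u} [Semiring A] [Algebra K A]
    (g : A ≃ₐ[K] A) : Prop :=
  ∀ S : Finset A, ∃ U : Aˣ, ∀ x ∈ S, g x = U * x * (U⁻¹ : Aˣ)

end Skew

namespace DirectedGraph

variable {K : Type w} [Field K] (E : DirectedGraph.{u, v}) [Fintype E.E0] [Fintype E.E1]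

/-- The deformation `L^g(E) = L(E)_0[t₊, t₋; g ∘ α]` of `L(E)` by an automorphism `g` of `L(E)_0`,
where `α(x) = t₊ x t₋` is the corner map for the choice `c` of edges. -/
abbrev DeformedLPA (c : E.E0 → E.E1) (hc : ∀ a, E.r (c a) = a)
    (g : LPA.zeroComponent K E ≃ₐ[K] LPA.zeroComponent K E) : Type (max u v w) :=
  SkewMonoidRing K
    ((g : LPA.zeroComponent K E →ₙₐ[K] LPA.zeroComponent K E).comp (LPA.cornerMap K E c hc))

end DirectedGraph

/-- The graph with vertices `v = 0` and `w = 1` and edges `e = 0` (a loop at `v`), `f = 1` (from `v`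
to `w`) and `g = 2` (a loop at `w`). -/
def twoLoopGraph : DirectedGraph.{0, 0} where
  E0 := Fin 2
  E1 := Fin 3
  s := ![0, 0, 1]
  r := ![0, 1, 1]

instance : Fintype twoLoopGraph.E0 := inferInstanceAs (Fintype (Fin 2))

instance : Fintype twoLoopGraph.E1 := inferInstanceAs (Fintype (Fin 3))

theorem twoLoopGraph_adjMatrix :
    twoLoopGraph.adjMatrix = (!![1, 0; 1, 1] : Matrix (Fin 2) (Fin 2) ℕ).transpose := by
  have key : ∀ i j : Fin 2,
      Nat.card {e : Fin 3 // (![0, 0, 1] : Fin 3 → Fin 2) e = i ∧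
        (![0, 1, 1] : Fin 3 → Fin 2) e = j} =
      (!![1, 0; 1, 1] : Matrix (Fin 2) (Fin 2) ℕ).transpose i j := by
    intro i j
    rw [Nat.card_eq_fintype_card]
    fin_cases i <;> fin_cases j <;> rfl
  funext i j
  exact key i j

/-- The choice of edges giving `t₊ = e + g` and `t₋ = e* + g*`. -/
def twoLoopChoice : twoLoopGraph.E0 → twoLoopGraph.E1 := (![0, 2] : Fin 2 → Fin 3)

theorem twoLoopChoice_spec : ∀ a : twoLoopGraph.E0, twoLoopGraph.r (twoLoopChoice a) = a := by
  change ∀ a : Fin 2, (![0, 1, 1] : Fin 3 → Fin 2) ((![0, 2] : Fin 2 → Fin 3) a) = a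
  decide

open DirectedGraph

/-! Let L(E) act on the space with basis the infinite paths b_0 = γγγ⋯ and b_{i+1} = eⁱfγγγ⋯: an
edge is prepended, a ghost edge removes the first edge. In degree zero this action is faithful, and
L(E)_0 becomes the scalars plus the matrices with finitely many nonzero entries
(`one_eps_induction`, `rep_injOn`). The element t₊ fixes b_0 and shifts b_i to b_{i+1} for i ≥ 1.

Let g be conjugation by the permutation that exchanges b_{2k} and b_{2k+1} for every k ≥ 1. Finitely
many elements of L(E)_0 involve only finitely many matrix entries, so on them g agrees with
conjugation by a finite part of the permutation, which is a unit of L(E)_0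
(`isLocallyInner_swapAut`).

The deformation acts on the same space, with s₊ the shift followed by the permutation. The two
cancel on b_{2k}, so s₊ and s₋ fix b_{2k} for k ≥ 1, and each element of L(E)_0 is scalar on b_i for
large i. Hence each element of the deformation has all but finitely many b_{2k} as eigenvectors
(`exists_mem_eigenSubalgebra`). Under finite generation one bound would serve for all elements,
which a matrix unit refutes (`eigenSubalgebra_ne_top`). Leavitt path algebras of finite graphs are
finitely generated, so none of them is isomorphic to the deformation. -/

/-- The Leavitt path algebra of a finite graph is finitely generated. -/
theorem DirectedGraph.LPA.finiteType (K : Type w) [Field K] (F : DirectedGraph.{u, v})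
    [Fintype F.E0] [Fintype F.E1] : Algebra.FiniteType K (LPA K F) := by
  have : Finite (Gen F) := by
    refine Finite.of_surjective (α := F.E0 ⊕ F.E1 ⊕ F.E1)
      (Sum.elim .vertex (Sum.elim .edge .ghost)) ?_
    rintro (a | e | e)
    · exact ⟨.inl a, rfl⟩
    · exact ⟨.inr (.inl e), rfl⟩
    · exact ⟨.inr (.inr e), rfl⟩
  have : Algebra.FiniteType K (FreeAlgebra K (Gen F)) := by
    refine ⟨⟨(Set.finite_range (FreeAlgebra.ι K)).toFinset, ?_⟩⟩
    rw [Set.Finite.coe_toFinset]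
    exact FreeAlgebra.adjoin_range_ι K (Gen F)
  exact this.of_surjective (RingQuot.mkAlgHom K (LeavittRel K F))
    (RingQuot.mkAlgHom_surjective K (LeavittRel K F))

namespace TwoLoop

/-! ### The representation on infinite paths ending in γγγ⋯ -/

section Rep

variable (K : Type w) [Field K]

/-- The operator on `ℕ →₀ K` with prescribed values on the standard basis. -/
noncomputable abbrev op (f : ℕ → ℕ →₀ K) : Module.End K (ℕ →₀ K) := Finsupp.linearCombination K f

/-- The standard basis vectors of `ℕ →₀ K`. -/
noncomputable abbrev bas (i : ℕ) : ℕ →₀ K := Finsupp.single i 1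

variable {K} in
theorem end_ext {x y : Module.End K (ℕ →₀ K)} (h : ∀ i, x (bas K i) = y (bas K i)) : x = y := by
  ext i : 2
  simpa using h i

theorem op_bas (f : ℕ → ℕ →₀ K) (i : ℕ) : op K f (bas K i) = f i := by
  simp [op, bas]

/-- The action of the generators of the Leavitt path algebra on `ℕ →₀ K`. The basis vector `0`
spans the range of the vertex `w`, and the basis vector `i + 1` is the image of it under
the path `eⁱ f`. -/
noncomputable def genOp : Gen twoLoopGraph → Module.End K (ℕ →₀ K)
  | .vertex a => (![op K fun i => if i = 0 then 0 else bas K i,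
      op K fun i => if i = 0 then bas K 0 else 0] : Fin 2 → _) a
  | .edge a => (![op K fun i => if i = 0 then 0 else bas K (i + 1),
      op K fun i => if i = 0 then bas K 1 else 0,
      op K fun i => if i = 0 then bas K 0 else 0] : Fin 3 → _) a
  | .ghost a => (![op K fun i => if i ≤ 1 then 0 else bas K (i - 1),
      op K fun i => if i = 1 then bas K 0 else 0,
      op K fun i => if i = 0 then bas K 0 else 0] : Fin 3 → _) a

theorem genOp_vertex_zero (i : ℕ) : genOp K (.vertex (0 : Fin 2)) (bas K i) =
    if i = 0 then 0 else bas K i := op_bas K _ i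

theorem genOp_vertex_one (i : ℕ) : genOp K (.vertex (1 : Fin 2)) (bas K i) =
    if i = 0 then bas K 0 else 0 := op_bas K _ i

theorem genOp_edge_zero (i : ℕ) : genOp K (.edge (0 : Fin 3)) (bas K i) =
    if i = 0 then 0 else bas K (i + 1) := op_bas K _ i

theorem genOp_edge_one (i : ℕ) : genOp K (.edge (1 : Fin 3)) (bas K i) =
    if i = 0 then bas K 1 else 0 := op_bas K _ i

theorem genOp_edge_two (i : ℕ) : genOp K (.edge (2 : Fin 3)) (bas K i) =
    if i = 0 then bas K 0 else 0 := op_bas K _ i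

theorem genOp_ghost_zero (i : ℕ) : genOp K (.ghost (0 : Fin 3)) (bas K i) =
    if i ≤ 1 then 0 else bas K (i - 1) := op_bas K _ i

theorem genOp_ghost_one (i : ℕ) : genOp K (.ghost (1 : Fin 3)) (bas K i) =
    if i = 1 then bas K 0 else 0 := op_bas K _ i

theorem genOp_ghost_two (i : ℕ) : genOp K (.ghost (2 : Fin 3)) (bas K i) =
    if i = 0 then bas K 0 else 0 := op_bas K _ i

theorem forall_vertex {P : twoLoopGraph.E0 → Prop} (h0 : P (0 : Fin 2)) (h1 : P (1 : Fin 2)) :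
    ∀ a, P a :=
  (Fin.forall_fin_two (p := P)).2 ⟨h0, h1⟩

theorem forall_edge {P : twoLoopGraph.E1 → Prop} (h0 : P (0 : Fin 3)) (h1 : P (1 : Fin 3))
    (h2 : P (2 : Fin 3)) : ∀ a, P a :=
  (Fin.forall_fin_succ (P := P)).2 ⟨h0, Fin.forall_fin_two.2 ⟨h1, h2⟩⟩

theorem source_zero : twoLoopGraph.s (0 : Fin 3) = (0 : Fin 2) := rfl
theorem source_one : twoLoopGraph.s (1 : Fin 3) = (0 : Fin 2) := rfl
theorem source_two : twoLoopGraph.s (2 : Fin 3) = (1 : Fin 2) := rfl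
theorem range_zero : twoLoopGraph.r (0 : Fin 3) = (0 : Fin 2) := rfl
theorem range_one : twoLoopGraph.r (1 : Fin 3) = (1 : Fin 2) := rfl
theorem range_two : twoLoopGraph.r (2 : Fin 3) = (1 : Fin 2) := rfl

open Classical in
theorem sum_edges_zero {M : Type*} [AddCommMonoid M] (f : twoLoopGraph.E1 → M) :
    ∑ e ∈ Finset.univ.filter (fun e => twoLoopGraph.s e = (0 : Fin 2)), f e =
      f (0 : Fin 3) + f (1 : Fin 3) := by
  rw [Finset.sum_filter]
  refine (Fin.sum_univ_three (fun e : Fin 3 =>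
    if twoLoopGraph.s e = (0 : Fin 2) then f e else 0)).trans ?_
  rw [if_pos source_zero, if_pos source_one, if_neg, add_zero]
  exact (by decide : (1 : Fin 2) ≠ 0)

open Classical in
theorem sum_edges_one {M : Type*} [AddCommMonoid M] (f : twoLoopGraph.E1 → M) :
    ∑ e ∈ Finset.univ.filter (fun e => twoLoopGraph.s e = (1 : Fin 2)), f e =
      f (2 : Fin 3) := by
  rw [Finset.sum_filter]
  refine (Fin.sum_univ_three (fun e : Fin 3 =>
    if twoLoopGraph.s e = (1 : Fin 2) then f e else 0)).trans ?_
  rw [if_neg, if_neg, if_pos source_two, zero_add, zero_add]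
  · exact (by decide : (0 : Fin 2) ≠ 1)
  · exact (by decide : (0 : Fin 2) ≠ 1)

theorem sum_vertices {M : Type*} [AddCommMonoid M] (f : twoLoopGraph.E0 → M) :
    ∑ a, f a = f (0 : Fin 2) + f (1 : Fin 2) := Fin.sum_univ_two f

/-- The relation at v = ∑ ee* expresses that an infinite path starting at v begins with e or with f;
at w only γ can come first. Everything is checked on basis vectors. -/
theorem lift_genOp_rel ⦃x y : FreeAlgebra K (Gen twoLoopGraph)⦄
    (h : LeavittRel K twoLoopGraph x y) :
    FreeAlgebra.lift K (genOp K) x = FreeAlgebra.lift K (genOp K) y := by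
  refine end_ext fun i => ?_
  cases h with
  | vertex_idem a =>
    revert a
    apply forall_vertex <;>
    · simp only [map_mul, FreeAlgebra.lift_ι_apply, Module.End.mul_apply, genOp_vertex_zero,
        genOp_vertex_one]
      split_ifs <;> simp_all [genOp_vertex_zero, genOp_vertex_one]
  | vertex_orth a b hab =>
    revert a b
    apply forall_vertex <;> apply forall_vertex <;> intro hab <;>
    first
    | exact absurd rfl hab
    | simp only [map_mul, FreeAlgebra.lift_ι_apply, Module.End.mul_apply, genOp_vertex_zero,
        genOp_vertex_one]
      split_ifs <;> simp_all [genOp_vertex_zero, genOp_vertex_one]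
  | source_edge e =>
    revert e
    apply forall_edge <;> simp only [source_zero, source_one, source_two] <;>
    · simp only [map_mul, FreeAlgebra.lift_ι_apply, Module.End.mul_apply,
        genOp_edge_zero, genOp_edge_one, genOp_edge_two]
      split_ifs <;> simp_all [genOp_vertex_zero, genOp_vertex_one]
  | edge_range e =>
    revert e
    apply forall_edge <;> simp only [range_zero, range_one, range_two] <;>
    · simp only [map_mul, FreeAlgebra.lift_ι_apply, Module.End.mul_apply,
        genOp_vertex_zero, genOp_vertex_one]
      split_ifs <;> simp_all [genOp_edge_zero, genOp_edge_one, genOp_edge_two]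
  | range_ghost e =>
    revert e
    apply forall_edge <;> simp only [range_zero, range_one, range_two] <;>
    · simp only [map_mul, FreeAlgebra.lift_ι_apply, Module.End.mul_apply,
        genOp_ghost_zero, genOp_ghost_one, genOp_ghost_two]
      split_ifs <;> simp_all [genOp_vertex_zero, genOp_vertex_one] <;> omega
  | ghost_source e =>
    revert e
    apply forall_edge <;> simp only [source_zero, source_one, source_two] <;>
    · simp only [map_mul, FreeAlgebra.lift_ι_apply, Module.End.mul_apply,
        genOp_vertex_zero, genOp_vertex_one]
      split_ifs <;> simp_all [genOp_ghost_zero, genOp_ghost_one, genOp_ghost_two]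
  | ck1_same e =>
    revert e
    apply forall_edge <;> simp only [range_zero, range_one, range_two] <;>
    · simp only [map_mul, FreeAlgebra.lift_ι_apply, Module.End.mul_apply,
        genOp_edge_zero, genOp_edge_one, genOp_edge_two]
      split_ifs <;> simp_all [genOp_ghost_zero, genOp_ghost_one, genOp_ghost_two,
        genOp_vertex_zero, genOp_vertex_one]
  | ck1_distinct e f hef =>
    revert e f
    apply forall_edge <;> apply forall_edge <;> intro hef <;>
    first
    | exact absurd rfl hef
    | simp only [map_mul, FreeAlgebra.lift_ι_apply, Module.End.mul_apply,
        genOp_edge_zero, genOp_edge_one, genOp_edge_two]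
      split_ifs <;> simp_all [genOp_ghost_zero, genOp_ghost_one, genOp_ghost_two]
  | ck2 a ha =>
    clear ha
    revert a
    apply forall_vertex
    · rw [sum_edges_zero]
      simp only [map_mul, map_add, FreeAlgebra.lift_ι_apply, Module.End.mul_apply,
        LinearMap.add_apply, genOp_ghost_zero, genOp_ghost_one, genOp_vertex_zero]
      rcases i with _ | _ | i <;> simp [genOp_edge_zero, genOp_edge_one]
    · rw [sum_edges_one]
      simp only [map_mul, FreeAlgebra.lift_ι_apply, Module.End.mul_apply,
        genOp_ghost_two, genOp_vertex_one]
      split_ifs <;> simp [genOp_edge_two]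
  | sum_vertex =>
    rw [sum_vertices]
    simp only [map_add, map_one, FreeAlgebra.lift_ι_apply, Module.End.one_apply,
      LinearMap.add_apply, genOp_vertex_zero, genOp_vertex_one]
    split_ifs <;> simp_all

/-- The representation of the Leavitt path algebra on `ℕ →₀ K`. -/
noncomputable def rep : LPA K twoLoopGraph →ₐ[K] Module.End K (ℕ →₀ K) :=
  RingQuot.liftAlgHom K ⟨FreeAlgebra.lift K (genOp K), lift_genOp_rel K⟩

theorem rep_vertex (a : twoLoopGraph.E0) : rep K (LPA.vertex K _ a) = genOp K (.vertex a) := by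
  rw [rep, LPA.vertex, RingQuot.liftAlgHom_mkAlgHom_apply, FreeAlgebra.lift_ι_apply]

theorem rep_edge (a : twoLoopGraph.E1) : rep K (LPA.edge K _ a) = genOp K (.edge a) := by
  rw [rep, LPA.edge, RingQuot.liftAlgHom_mkAlgHom_apply, FreeAlgebra.lift_ι_apply]

theorem rep_ghost (a : twoLoopGraph.E1) : rep K (LPA.ghost K _ a) = genOp K (.ghost a) := by
  rw [rep, LPA.ghost, RingQuot.liftAlgHom_mkAlgHom_apply, FreeAlgebra.lift_ι_apply]

end Rep

/-! ### The degree zero component as scalars plus finitary matrices -/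

section Elements

variable (K : Type w) [Field K]

/-- The vertex `v`. -/
noncomputable def v0 : LPA K twoLoopGraph := LPA.vertex K twoLoopGraph (0 : Fin 2)
/-- The vertex `w`. -/
noncomputable def w0 : LPA K twoLoopGraph := LPA.vertex K twoLoopGraph (1 : Fin 2)
/-- The loop `e` at `v`. -/
noncomputable def ed : LPA K twoLoopGraph := LPA.edge K twoLoopGraph (0 : Fin 3)
/-- The edge `f` from `v` to `w`. -/
noncomputable def fd : LPA K twoLoopGraph := LPA.edge K twoLoopGraph (1 : Fin 3)
/-- The loop `γ` at `w`. -/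
noncomputable def gd : LPA K twoLoopGraph := LPA.edge K twoLoopGraph (2 : Fin 3)
/-- The element `e*`. -/
noncomputable def es : LPA K twoLoopGraph := LPA.ghost K twoLoopGraph (0 : Fin 3)
/-- The element `f*`. -/
noncomputable def fs : LPA K twoLoopGraph := LPA.ghost K twoLoopGraph (1 : Fin 3)
/-- The element `γ*`. -/
noncomputable def gs : LPA K twoLoopGraph := LPA.ghost K twoLoopGraph (2 : Fin 3)

theorem v0_mul_v0 : v0 K * v0 K = v0 K := LPA.vertex_idem K _ _
theorem w0_mul_w0 : w0 K * w0 K = w0 K := LPA.vertex_idem K _ _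
theorem v0_mul_w0 : v0 K * w0 K = 0 := LPA.vertex_orth K _ (by exact (by decide : (0 : Fin 2) ≠ 1))
theorem w0_mul_v0 : w0 K * v0 K = 0 := LPA.vertex_orth K _ (by exact (by decide : (1 : Fin 2) ≠ 0))
theorem v0_mul_ed : v0 K * ed K = ed K := LPA.source_edge K twoLoopGraph (0 : Fin 3)
theorem v0_mul_fd : v0 K * fd K = fd K := LPA.source_edge K twoLoopGraph (1 : Fin 3)
theorem w0_mul_gd : w0 K * gd K = gd K := LPA.source_edge K twoLoopGraph (2 : Fin 3)
theorem ed_mul_v0 : ed K * v0 K = ed K := LPA.edge_range K twoLoopGraph _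
theorem fd_mul_w0 : fd K * w0 K = fd K := LPA.edge_range K twoLoopGraph _
theorem gd_mul_w0 : gd K * w0 K = gd K := LPA.edge_range K twoLoopGraph _
theorem es_mul_v0 : es K * v0 K = es K := LPA.ghost_source K twoLoopGraph _
theorem fs_mul_v0 : fs K * v0 K = fs K := LPA.ghost_source K twoLoopGraph _
theorem gs_mul_w0 : gs K * w0 K = gs K := LPA.ghost_source K twoLoopGraph _
theorem v0_mul_es : v0 K * es K = es K := LPA.range_ghost K twoLoopGraph (0 : Fin 3)
theorem w0_mul_fs : w0 K * fs K = fs K := LPA.range_ghost K twoLoopGraph (1 : Fin 3)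
theorem w0_mul_gs : w0 K * gs K = gs K := LPA.range_ghost K twoLoopGraph (2 : Fin 3)
theorem gs_mul_gd : gs K * gd K = w0 K := LPA.ck1_same K twoLoopGraph _

theorem v0_add_w0 : v0 K + w0 K = 1 := by
  rw [← LPA.sum_vertex K twoLoopGraph, sum_vertices]; rfl

theorem v0_eq : v0 K = ed K * es K + fd K * fs K := by
  have h := RingQuot.mkAlgHom_rel K
    (LeavittRel.ck2 (K := K) (E := twoLoopGraph) (0 : Fin 2) ⟨(0 : Fin 3), rfl⟩)
  rw [sum_edges_zero] at h
  rw [map_add, map_mul, map_mul] at h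
  exact h

theorem w0_eq : w0 K = gd K * gs K := by
  have h := RingQuot.mkAlgHom_rel K
    (LeavittRel.ck2 (K := K) (E := twoLoopGraph) (1 : Fin 2) ⟨(2 : Fin 3), rfl⟩)
  rw [sum_edges_one] at h
  rw [map_mul] at h
  exact h

theorem w0_mul_ed : w0 K * ed K = 0 := by
  rw [← v0_mul_ed, ← mul_assoc, w0_mul_v0, zero_mul]
theorem w0_mul_fd : w0 K * fd K = 0 := by
  rw [← v0_mul_fd, ← mul_assoc, w0_mul_v0, zero_mul]
theorem ed_mul_w0 : ed K * w0 K = 0 := by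
  rw [← ed_mul_v0, mul_assoc, v0_mul_w0, mul_zero]
theorem es_mul_w0 : es K * w0 K = 0 := by
  rw [← es_mul_v0, mul_assoc, v0_mul_w0, mul_zero]
theorem fs_mul_w0 : fs K * w0 K = 0 := by
  rw [← fs_mul_v0, mul_assoc, v0_mul_w0, mul_zero]
theorem w0_mul_es : w0 K * es K = 0 := by
  rw [← v0_mul_es, ← mul_assoc, w0_mul_v0, zero_mul]

/-- The elements `w` and `eⁱ f (γ*)ⁱ⁺¹` of degree zero. -/
noncomputable def eta : ℕ → LPA K twoLoopGraph
  | 0 => w0 K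
  | 1 => fd K * gs K
  | n + 2 => ed K * eta (n + 1) * gs K

/-- The elements `w` and `γⁱ⁺¹ f* (e*)ⁱ` of degree zero. -/
noncomputable def etaStar : ℕ → LPA K twoLoopGraph
  | 0 => w0 K
  | 1 => gd K * fs K
  | n + 2 => gd K * etaStar (n + 1) * es K

/-- The matrix units of the degree zero component. -/
noncomputable def eps (i j : ℕ) : LPA K twoLoopGraph := eta K i * etaStar K j

theorem eta_mul_w0 (i : ℕ) : eta K i * w0 K = eta K i := by
  rcases i with _ | _ | i
  · exact w0_mul_w0 K
  · rw [eta, mul_assoc, gs_mul_w0]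
  · rw [eta, mul_assoc, gs_mul_w0]

theorem w0_mul_etaStar (i : ℕ) : w0 K * etaStar K i = etaStar K i := by
  rcases i with _ | _ | i
  · exact w0_mul_w0 K
  · rw [etaStar, ← mul_assoc, w0_mul_gd]
  · rw [etaStar, ← mul_assoc, ← mul_assoc, w0_mul_gd]

theorem w0_mul_eta_succ (i : ℕ) : w0 K * eta K (i + 1) = 0 := by
  rcases i with _ | i
  · rw [eta, ← mul_assoc, w0_mul_fd, zero_mul]
  · rw [eta, ← mul_assoc, ← mul_assoc, w0_mul_ed, zero_mul, zero_mul]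

theorem etaStar_succ_mul_w0 (i : ℕ) : etaStar K (i + 1) * w0 K = 0 := by
  rcases i with _ | i
  · rw [etaStar, mul_assoc, fs_mul_w0, mul_zero]
  · rw [etaStar, mul_assoc, es_mul_w0, mul_zero]

/-- The γ on the right cancels the trailing γ* of `eta`. In this way a path is traded for a degree
zero factor times a power of γ that records its length. -/
theorem ed_mul_eta_succ (i : ℕ) : ed K * eta K (i + 1) = eta K (i + 2) * gd K := by
  rw [eta, mul_assoc, mul_assoc, gs_mul_gd, eta_mul_w0]

theorem etaStar_succ_mul_es (i : ℕ) : etaStar K (i + 1) * es K = gs K * etaStar K (i + 2) := by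
  rw [etaStar, ← mul_assoc, ← mul_assoc, gs_mul_gd, w0_mul_etaStar]

theorem fd_eq : fd K = eta K 1 * gd K := by
  rw [eta, mul_assoc, gs_mul_gd, fd_mul_w0]

theorem fs_eq : fs K = gs K * etaStar K 1 := by
  rw [etaStar, ← mul_assoc, gs_mul_gd, w0_mul_fs]

/-- Only γ leaves w, so γγ* = w and γ is invertible in the corner at w. The factor w on the left is
what makes the case n = 0 correct. -/
theorem gd_pow_mul_gs_pow (n : ℕ) : w0 K * gd K ^ n * gs K ^ n = w0 K := by
  induction n with
  | zero => simp
  | succ n ih =>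
    rw [pow_succ, pow_succ']
    calc w0 K * (gd K ^ n * gd K) * (gs K * gs K ^ n)
        = w0 K * gd K ^ n * (gd K * gs K) * gs K ^ n := by simp only [mul_assoc]
      _ = w0 K := by
        rw [← w0_eq]
        cases n with
        | zero => simp [w0_mul_w0]
        | succ n =>
          rw [pow_succ, mul_assoc (w0 K), mul_assoc (gd K ^ n), gd_mul_w0, ← pow_succ]
          exact ih

/-- A path ending at w is γᵏ or eⁱfγᵏ; padding with γ*γ gives the form `eta i` γⁿ with n the full
length. For two paths of equal length the powers of γ then cancel in pq*, leaving a matrix unit. The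
alternative 0 absorbs the cases of the induction where the index i does not fit the range of the new
edge, since i is not tied to the starting vertex. -/
theorem ofPath_of_range_eq_one {a b : twoLoopGraph.E0} {n : ℕ} (p : Path twoLoopGraph a b n)
    (hb : b = (1 : Fin 2)) :
    (∃ i, LPA.ofPath K _ p = eta K i * gd K ^ n ∧ LPA.ofPathStar K _ p = gs K ^ n * etaStar K i) ∨
      (LPA.ofPath K _ p = 0 ∧ LPA.ofPathStar K _ p = 0) := by
  induction p with
  | nil a =>
    subst hb
    exact .inl ⟨0, by rw [pow_zero, mul_one]; rfl, by rw [pow_zero, one_mul]; rfl⟩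
  | @cons e b n p ih =>
    rcases ih hb with ⟨i, h1, h2⟩ | ⟨h1, h2⟩
    · simp only [LPA.ofPath, LPA.ofPathStar, h1, h2]
      clear h1 h2 ih p hb
      simp only [← mul_assoc, pow_succ' (gd K), pow_succ (gs K)]
      simp only [mul_assoc (gs K ^ n)]
      revert e
      apply forall_edge
      · change (∃ j, ed K * _ * _ = _ ∧ gs K ^ n * (_ * es K) = _) ∨
          ed K * _ * _ = _ ∧ gs K ^ n * (_ * es K) = _
        rcases i with _ | i
        · right
          rw [eta, etaStar, ed_mul_w0, w0_mul_es, zero_mul, mul_zero]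
          exact ⟨rfl, rfl⟩
        · left
          exact ⟨i + 2, by rw [ed_mul_eta_succ], by rw [etaStar_succ_mul_es]⟩
      · change (∃ j, fd K * _ * _ = _ ∧ gs K ^ n * (_ * fs K) = _) ∨
          fd K * _ * _ = _ ∧ gs K ^ n * (_ * fs K) = _
        rcases i with _ | i
        · left
          refine ⟨1, ?_, ?_⟩
          · rw [← fd_eq, eta, fd_mul_w0]
          · rw [← fs_eq, etaStar, w0_mul_fs]
        · right
          rw [← fd_mul_w0, ← w0_mul_fs, mul_assoc (fd K), w0_mul_eta_succ,
            ← mul_assoc (etaStar K _), etaStar_succ_mul_w0]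
          simp
      · change (∃ j, gd K * _ * _ = _ ∧ gs K ^ n * (_ * gs K) = _) ∨
          gd K * _ * _ = _ ∧ gs K ^ n * (_ * gs K) = _
        rcases i with _ | i
        · left
          refine ⟨0, ?_, ?_⟩
          · rw [eta, gd_mul_w0, w0_mul_gd]
          · rw [etaStar, gs_mul_w0, w0_mul_gs]
        · right
          rw [← gd_mul_w0, ← w0_mul_gs, mul_assoc (gd K), w0_mul_eta_succ,
            ← mul_assoc (etaStar K _), etaStar_succ_mul_w0]
          simp
    · right
      rw [LPA.ofPath, LPA.ofPathStar, h1, h2, mul_zero, zero_mul]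
      exact ⟨rfl, rfl⟩

/-- Only e enters v, so a path ending at v is a power of e. An edge f or γ in front meets a path
that would have to start at both v and w, so the product is 0. -/
theorem ofPath_of_range_eq_zero {a b : twoLoopGraph.E0} {n : ℕ} (p : Path twoLoopGraph a b n)
    (hb : b = (0 : Fin 2)) :
    (LPA.ofPath K _ p = ed K ^ n * v0 K ∧ LPA.ofPathStar K _ p = v0 K * es K ^ n) ∨
      (LPA.ofPath K _ p = 0 ∧ LPA.ofPathStar K _ p = 0) := by
  induction p with
  | nil a =>
    subst hb
    exact .inl ⟨by rw [pow_zero, one_mul]; rfl, by rw [pow_zero, mul_one]; rfl⟩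
  | @cons e b n p ih =>
    rcases ih hb with ⟨h1, h2⟩ | ⟨h1, h2⟩
    · revert e
      apply forall_edge
      · intro p _ h1 h2
        change (ed K * _ = _ ∧ _ * es K = _) ∨ _
        rw [h1, h2]
        exact .inl ⟨by rw [pow_succ', mul_assoc], by rw [pow_succ, ← mul_assoc]⟩
      all_goals
        intro p _ h1 h2
        right
        change LPA.edge K twoLoopGraph _ * _ = _ ∧ _ * LPA.ghost K twoLoopGraph _ = _
        have h3 : w0 K * LPA.ofPath K _ p = LPA.ofPath K _ p := LPA.vertex_mul_ofPath K _ p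
        have h4 : LPA.ofPathStar K _ p * w0 K = LPA.ofPathStar K _ p :=
          LPA.ofPathStar_mul_vertex K _ p
        have h5 : w0 K * (ed K ^ n * v0 K) = 0 := by
          cases n with
          | zero => rw [pow_zero, one_mul, w0_mul_v0]
          | succ n => rw [pow_succ', ← mul_assoc, ← mul_assoc, w0_mul_ed, zero_mul, zero_mul]
        have h6 : v0 K * es K ^ n * w0 K = 0 := by
          cases n with
          | zero => rw [pow_zero, mul_one, v0_mul_w0]
          | succ n => rw [pow_succ, mul_assoc, mul_assoc, es_mul_w0, mul_zero, mul_zero]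
        rw [← h3, ← h4, h1, h2, h5, h6, mul_zero, zero_mul]
        exact ⟨rfl, rfl⟩
    · right
      rw [LPA.ofPath, LPA.ofPathStar, h1, h2, mul_zero, zero_mul]
      exact ⟨rfl, rfl⟩

theorem ed_pow_mul_fd (n : ℕ) : ed K ^ n * fd K = eta K (n + 1) * gd K ^ (n + 1) := by
  induction n with
  | zero => rw [pow_zero, one_mul, zero_add, pow_one, fd_eq]
  | succ n ih =>
    rw [pow_succ', mul_assoc, ih, ← mul_assoc, ed_mul_eta_succ, mul_assoc, ← pow_succ']

theorem fs_mul_es_pow (n : ℕ) : fs K * es K ^ n = gs K ^ (n + 1) * etaStar K (n + 1) := by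
  induction n with
  | zero => rw [pow_zero, mul_one, zero_add, pow_one, fs_eq]
  | succ n ih =>
    rw [pow_succ, ← mul_assoc, ih, mul_assoc, etaStar_succ_mul_es, ← mul_assoc, ← pow_succ]

theorem eta_mul_gd_pow_mul (i j n : ℕ) :
    eta K i * gd K ^ n * (gs K ^ n * etaStar K j) = eps K i j := by
  rw [← eta_mul_w0, eps]
  calc _ = eta K i * (w0 K * gd K ^ n * gs K ^ n) * etaStar K j := by simp only [mul_assoc]
    _ = _ := by rw [gd_pow_mul_gs_pow, eta_mul_w0]

/-- Substituting v = ee* + ff* between eⁿ and (e*)ⁿ splits off eⁿff*(e*)ⁿ, the diagonal matrix unit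
of index n + 1. The identity telescopes from v = 1 - w. -/
theorem ed_pow_mul_v0_mul_es_pow (n : ℕ) :
    ed K ^ n * v0 K * es K ^ n = 1 - ∑ i ∈ Finset.range (n + 1), eps K i i := by
  induction n with
  | zero =>
    rw [pow_zero, pow_zero, one_mul, mul_one, Finset.sum_range_one, eps, eta, etaStar, w0_mul_w0,
      ← v0_add_w0, add_sub_cancel_right]
  | succ n ih =>
    rw [Finset.sum_range_succ, ← sub_sub, ← ih, ← eta_mul_gd_pow_mul K (n + 1) (n + 1) (n + 1),
      ← ed_pow_mul_fd, ← fs_mul_es_pow, v0_eq, pow_succ, pow_succ']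
    -- This is ee* = eve* with v expanded. It contracts the left side to eⁿ(ee*)(e*)ⁿ, and the ff*
    -- terms on the right cancel.
    have h : ed K * es K = ed K * (ed K * es K + fd K * fs K) * es K := by
      rw [← v0_eq, ed_mul_v0]
    calc _ = ed K ^ n * (ed K * (ed K * es K + fd K * fs K) * es K) * es K ^ n := by
          simp only [mul_assoc]
      _ = _ := by rw [← h]; noncomm_ring

/-- By the normal forms, pq* with p, q of equal length is a matrix unit, or 1 minus finitely many of
them, or 0. Later statements on degree zero elements are linear in the element and are checked only
on 1 and the matrix units. -/
theorem one_eps_induction {P : LPA K twoLoopGraph → Prop} (h1 : P 1)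
    (heps : ∀ i j, P (eps K i j)) (hadd : ∀ x y, P x → P y → P (x + y))
    (hsmul : ∀ (c : K) x, P x → P (c • x)) {x : LPA K twoLoopGraph}
    (hx : x ∈ LPA.zeroComponent K twoLoopGraph) : P x := by
  let S : Submodule K (LPA K twoLoopGraph) :=
    { carrier := {x | P x}
      add_mem' := fun {a b} => hadd a b
      zero_mem' := by simpa using hsmul 0 1 h1
      smul_mem' := hsmul }
  suffices h : LPA.degreeComponent K twoLoopGraph 0 ≤ S from h hx
  refine Submodule.span_le.2 ?_
  rintro _ ⟨a, b, c, m, n, p, q, hmn, rfl⟩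
  obtain rfl : m = n := by omega
  revert c
  apply forall_vertex
  · intro p q
    rcases ofPath_of_range_eq_zero K p rfl with ⟨hp, -⟩ | ⟨hp, -⟩
    · rcases ofPath_of_range_eq_zero K q rfl with ⟨-, hq⟩ | ⟨-, hq⟩
      · have : ed K ^ m * v0 K * (v0 K * es K ^ m) = ed K ^ m * v0 K * es K ^ m := by
          rw [← mul_assoc, mul_assoc (ed K ^ m), v0_mul_v0]
        rw [hp, hq, this, ed_pow_mul_v0_mul_es_pow]
        exact S.sub_mem h1 (S.sum_mem fun i _ => heps i i)
      · rw [hq, mul_zero]; exact S.zero_mem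
    · rw [hp, zero_mul]; exact S.zero_mem
  · intro p q
    rcases ofPath_of_range_eq_one K p rfl with ⟨i, hp, -⟩ | ⟨hp, -⟩
    · rcases ofPath_of_range_eq_one K q rfl with ⟨j, -, hq⟩ | ⟨-, hq⟩
      · rw [hp, hq, eta_mul_gd_pow_mul]
        exact heps i j
      · rw [hq, mul_zero]; exact S.zero_mem
    · rw [hp, zero_mul]; exact S.zero_mem

theorem w0_mem : w0 K ∈ LPA.zeroComponent K twoLoopGraph := by
  refine Submodule.subset_span ⟨_, _, _, 0, 0, Path.nil (E := twoLoopGraph) (1 : Fin 2),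
    Path.nil (E := twoLoopGraph) (1 : Fin 2), by simp, ?_⟩
  exact (w0_mul_w0 K).symm

theorem tPlus_eq : LPA.tPlus K twoLoopGraph twoLoopChoice = ed K + gd K :=
  sum_vertices fun a => LPA.edge K twoLoopGraph (twoLoopChoice a)

theorem tMinus_eq : LPA.tMinus K twoLoopGraph twoLoopChoice = es K + gs K :=
  sum_vertices fun a => LPA.ghost K twoLoopGraph (twoLoopChoice a)

theorem eta_mem (i : ℕ) : eta K i ∈ LPA.zeroComponent K twoLoopGraph := by
  rcases i with _ | i
  · exact w0_mem K
  induction i with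
  | zero =>
    refine Submodule.subset_span ⟨_, _, _, 1, 1, .cons (1 : Fin 3) (.nil _),
      .cons (2 : Fin 3) (.nil _), by simp, ?_⟩
    change fd K * gs K = fd K * w0 K * (w0 K * gs K)
    rw [fd_mul_w0, w0_mul_gs]
  | succ i ih =>
    -- In (e + γ) η (e* + γ*) only the term e η γ*, the next `eta`, survives, so membership follows
    -- from stability under the corner map.
    have h := LPA.tPlus_mul_mul_tMinus_mem K twoLoopGraph twoLoopChoice_spec ih
    have h1 : gd K * eta K (i + 1) = 0 := by
      rw [← gd_mul_w0, mul_assoc, w0_mul_eta_succ, mul_zero]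
    have h2 : ed K * eta K (i + 1) * es K = 0 := by
      rw [← eta_mul_w0, mul_assoc, mul_assoc, w0_mul_es, mul_zero, mul_zero]
    rwa [tPlus_eq, tMinus_eq, add_mul, h1, add_zero, mul_add, h2, zero_add] at h

theorem etaStar_mem (i : ℕ) : etaStar K i ∈ LPA.zeroComponent K twoLoopGraph := by
  rcases i with _ | i
  · exact w0_mem K
  induction i with
  | zero =>
    refine Submodule.subset_span ⟨_, _, _, 1, 1, .cons (2 : Fin 3) (.nil _),
      .cons (1 : Fin 3) (.nil _), by simp, ?_⟩
    change gd K * fs K = gd K * w0 K * (w0 K * fs K)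
    rw [gd_mul_w0, w0_mul_fs]
  | succ i ih =>
    have h := LPA.tPlus_mul_mul_tMinus_mem K twoLoopGraph twoLoopChoice_spec ih
    have h1 : ed K * etaStar K (i + 1) = 0 := by
      rw [← w0_mul_etaStar, ← mul_assoc, ed_mul_w0, zero_mul]
    have h2 : gd K * etaStar K (i + 1) * gs K = 0 := by
      rw [← w0_mul_gs, mul_assoc, ← mul_assoc (etaStar K _), etaStar_succ_mul_w0, zero_mul,
        mul_zero]
    rwa [tPlus_eq, tMinus_eq, add_mul, h1, zero_add, mul_add, h2, add_zero] at h

theorem eps_mem (i j : ℕ) : eps K i j ∈ LPA.zeroComponent K twoLoopGraph :=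
  mul_mem (eta_mem K i) (etaStar_mem K j)

theorem rep_w0 (k : ℕ) : rep K (w0 K) (bas K k) = if k = 0 then bas K 0 else 0 :=
  (congrArg (· (bas K k)) (rep_vertex K _)).trans (genOp_vertex_one K k)

theorem rep_ed (k : ℕ) : rep K (ed K) (bas K k) = if k = 0 then 0 else bas K (k + 1) :=
  (congrArg (· (bas K k)) (rep_edge K _)).trans (genOp_edge_zero K k)

theorem rep_fd (k : ℕ) : rep K (fd K) (bas K k) = if k = 0 then bas K 1 else 0 :=
  (congrArg (· (bas K k)) (rep_edge K _)).trans (genOp_edge_one K k)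

theorem rep_gd (k : ℕ) : rep K (gd K) (bas K k) = if k = 0 then bas K 0 else 0 :=
  (congrArg (· (bas K k)) (rep_edge K _)).trans (genOp_edge_two K k)

theorem rep_es (k : ℕ) : rep K (es K) (bas K k) = if k ≤ 1 then 0 else bas K (k - 1) :=
  (congrArg (· (bas K k)) (rep_ghost K _)).trans (genOp_ghost_zero K k)

theorem rep_fs (k : ℕ) : rep K (fs K) (bas K k) = if k = 1 then bas K 0 else 0 :=
  (congrArg (· (bas K k)) (rep_ghost K _)).trans (genOp_ghost_one K k)

theorem rep_gs (k : ℕ) : rep K (gs K) (bas K k) = if k = 0 then bas K 0 else 0 :=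
  (congrArg (· (bas K k)) (rep_ghost K _)).trans (genOp_ghost_two K k)

theorem rep_eta (i k : ℕ) : rep K (eta K i) (bas K k) = if k = 0 then bas K i else 0 := by
  rcases i with _ | i
  · exact rep_w0 K k
  induction i generalizing k with
  | zero =>
    rw [eta, map_mul, Module.End.mul_apply, rep_gs]
    split_ifs
    · rw [rep_fd, if_pos rfl]
    · rw [map_zero]
  | succ i ih =>
    rw [eta, mul_assoc, map_mul, map_mul, Module.End.mul_apply, Module.End.mul_apply, rep_gs]
    split_ifs
    · rw [ih, if_pos rfl, rep_ed, if_neg i.succ_ne_zero]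
    · rw [map_zero, map_zero]

theorem rep_etaStar (i k : ℕ) :
    rep K (etaStar K i) (bas K k) = if k = i then bas K 0 else 0 := by
  rcases i with _ | i
  · exact rep_w0 K k
  induction i generalizing k with
  | zero =>
    rw [etaStar, map_mul, Module.End.mul_apply, rep_fs]
    split_ifs
    · rw [rep_gd, if_pos rfl]
    · rw [map_zero]
  | succ i ih =>
    rw [etaStar, mul_assoc, map_mul, map_mul, Module.End.mul_apply, Module.End.mul_apply, rep_es]
    rcases k with _ | _ | k
    · simp
    · simp
    · simp only [show ¬ k + 1 + 1 ≤ 1 by omega, if_false, Nat.add_sub_cancel, ih,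
        show (k + 1 + 1 = i + 1 + 1) ↔ k + 1 = i + 1 by omega]
      split_ifs
      · rw [rep_gd, if_pos rfl]
      · rw [map_zero]

theorem rep_eps (i j k : ℕ) : rep K (eps K i j) (bas K k) = if k = j then bas K i else 0 := by
  rw [eps, map_mul, Module.End.mul_apply, rep_etaStar]
  split_ifs
  · rw [rep_eta, if_pos rfl]
  · rw [map_zero]

end Elements

/-! ### Faithfulness in degree zero and the locally inner automorphism -/

section Automorphism

variable (K : Type w) [Field K]

/-- The reconstruction of an element of degree zero from its operator on `ℕ →₀ K`. -/
noncomputable def reconstruct (M : ℕ) (φ : Module.End K (ℕ →₀ K)) : LPA K twoLoopGraph :=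
  φ (bas K M) M • (1 - ∑ i ∈ Finset.range M, eps K i i) +
    ∑ j ∈ Finset.range M, ∑ i ∈ Finset.range M, φ (bas K j) i • eps K i j

/-- For a scalar c plus a finitary matrix, the diagonal entry at a large position M is c, and the M
× M block gives the rest. -/
theorem reconstruct_rep {x : LPA K twoLoopGraph} (hx : x ∈ LPA.zeroComponent K twoLoopGraph) :
    ∃ N, ∀ M ≥ N, reconstruct K M (rep K x) = x := by
  refine one_eps_induction K (P := fun x => ∃ N, ∀ M ≥ N, reconstruct K M (rep K x) = x)
    ?_ ?_ ?_ ?_ hx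
  · refine ⟨0, fun M _ => ?_⟩
    have h : ∀ j ∈ Finset.range M, ∑ i ∈ Finset.range M, (bas K j) i • eps K i j = eps K j j := by
      intro j hj
      rw [Finset.sum_eq_single_of_mem j hj]
      · simp
      · intro i _ hi
        rw [Finsupp.single_eq_of_ne hi, zero_smul]
    rw [reconstruct, map_one]
    simp only [Module.End.one_apply]
    rw [Finset.sum_congr rfl h]
    simp
  · intro k l
    refine ⟨k + l + 1, fun M hM => ?_⟩
    rw [reconstruct]
    simp only [rep_eps]
    rw [if_neg (by omega), Finsupp.zero_apply, zero_smul, zero_add,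
      Finset.sum_eq_single_of_mem l (Finset.mem_range.2 (by omega)),
      Finset.sum_eq_single_of_mem k (Finset.mem_range.2 (by omega))]
    · simp
    · intro i _ hi
      rw [if_pos rfl, Finsupp.single_eq_of_ne hi, zero_smul]
    · intro j _ hj
      simp [hj]
  · rintro x y ⟨N, hN⟩ ⟨N', hN'⟩
    refine ⟨max N N', fun M hM => ?_⟩
    conv_rhs => rw [← hN M (le_of_max_le_left hM), ← hN' M (le_of_max_le_right hM)]
    simp only [reconstruct, map_add, LinearMap.add_apply, Finsupp.add_apply, add_smul,
      Finset.sum_add_distrib]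
    abel
  · rintro c x ⟨N, hN⟩
    refine ⟨N, fun M hM => ?_⟩
    conv_rhs => rw [← hN M hM]
    simp only [reconstruct, map_smul, LinearMap.smul_apply, Finsupp.smul_apply, smul_assoc,
      Finset.smul_sum, smul_add]

/-- Since `reconstruct` recovers x from its operator, identities in L(E)_0 may be verified on
operators. -/
theorem rep_injOn {x y : LPA K twoLoopGraph} (hx : x ∈ LPA.zeroComponent K twoLoopGraph)
    (hy : y ∈ LPA.zeroComponent K twoLoopGraph) (h : rep K x = rep K y) : x = y := by
  obtain ⟨N, hN⟩ := reconstruct_rep K hx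
  obtain ⟨N', hN'⟩ := reconstruct_rep K hy
  rw [← hN _ (le_max_left N N'), ← hN' _ (le_max_right N N'), h]

/-- The involution of `ℕ` that exchanges `2 k` and `2 k + 1` for all `k ≥ 1`. -/
def swapPairs (i : ℕ) : ℕ := if i ≤ 1 then i else if i % 2 = 0 then i + 1 else i - 1

theorem swapPairs_swapPairs (i : ℕ) : swapPairs (swapPairs i) = i := by
  unfold swapPairs
  split_ifs <;> omega

/-- The cut is at an even number so that no exchanged pair is split; the truncated permutation is
then again an involution. -/
theorem swapPairs_lt {i M : ℕ} : swapPairs i < 2 * M ↔ i < 2 * M := by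
  unfold swapPairs
  split_ifs <;> omega

/-- The operator permuting the basis of `ℕ →₀ K` by `swapPairs`. -/
noncomputable def swapOp : Module.End K (ℕ →₀ K) := op K fun i => bas K (swapPairs i)

theorem swapOp_bas (i : ℕ) : swapOp K (bas K i) = bas K (swapPairs i) := op_bas K _ i

theorem swapOp_mul_swapOp : swapOp K * swapOp K = 1 :=
  end_ext fun i => by
    rw [Module.End.mul_apply, swapOp_bas, swapOp_bas, swapPairs_swapPairs, Module.End.one_apply]

theorem rep_eps_swapPairs (i j : ℕ) : rep K (eps K (swapPairs i) (swapPairs j)) =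
    swapOp K * rep K (eps K i j) * swapOp K :=
  end_ext fun k => by
    rw [Module.End.mul_apply, Module.End.mul_apply, swapOp_bas, rep_eps, rep_eps]
    by_cases h : k = swapPairs j
    · rw [if_pos h, h, swapPairs_swapPairs, if_pos rfl, swapOp_bas]
    · rw [if_neg h, if_neg, map_zero]
      rintro rfl
      exact h (swapPairs_swapPairs k).symm

/-- The permutation moves infinitely many basis vectors and does not come from L(E)_0, but
conjugation by it only permutes the matrix units. -/
theorem exists_rep_eq_conj (x : LPA.zeroComponent K twoLoopGraph) :
    ∃ y : LPA.zeroComponent K twoLoopGraph, rep K y = swapOp K * rep K x * swapOp K := by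
  suffices h : ∃ y ∈ LPA.zeroComponent K twoLoopGraph, rep K y = swapOp K * rep K x * swapOp K by
    obtain ⟨y, hy, h⟩ := h
    exact ⟨⟨y, hy⟩, h⟩
  refine one_eps_induction K (P := fun x => ∃ y ∈ LPA.zeroComponent K twoLoopGraph,
    rep K y = swapOp K * rep K x * swapOp K) ?_ ?_ ?_ ?_ x.2
  · exact ⟨1, one_mem _, by rw [map_one, mul_one, swapOp_mul_swapOp]⟩
  · exact fun i j => ⟨_, eps_mem K _ _, rep_eps_swapPairs K i j⟩
  · rintro x y ⟨a, ha, hxa⟩ ⟨b, hb, hyb⟩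
    exact ⟨a + b, add_mem ha hb, by rw [map_add, map_add, hxa, hyb, mul_add, add_mul]⟩
  · rintro c x ⟨a, ha, hxa⟩
    exact ⟨c • a, Subalgebra.smul_mem _ ha c, by
      rw [map_smul, map_smul, hxa, mul_smul_comm, smul_mul_assoc]⟩

/-- The map of the degree zero component given by conjugation with `swapOp`. -/
noncomputable def swapFun (x : LPA.zeroComponent K twoLoopGraph) :
    LPA.zeroComponent K twoLoopGraph := (exists_rep_eq_conj K x).choose

theorem rep_swapFun (x : LPA.zeroComponent K twoLoopGraph) :
    rep K (swapFun K x) = swapOp K * rep K x * swapOp K := (exists_rep_eq_conj K x).choose_spec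

theorem zeroComponent_ext {x y : LPA.zeroComponent K twoLoopGraph}
    (h : rep K (x : LPA K twoLoopGraph) = rep K y) : x = y :=
  Subtype.ext (rep_injOn K x.2 y.2 h)

theorem conj_mul (x y : Module.End K (ℕ →₀ K)) :
    swapOp K * x * swapOp K * (swapOp K * y * swapOp K) = swapOp K * (x * y) * swapOp K := by
  calc _ = swapOp K * x * (swapOp K * swapOp K) * y * swapOp K := by simp only [mul_assoc]
    _ = _ := by rw [swapOp_mul_swapOp]; simp only [mul_assoc, one_mul]

theorem conj_conj (x : Module.End K (ℕ →₀ K)) :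
    swapOp K * (swapOp K * x * swapOp K) * swapOp K = x := by
  calc _ = (swapOp K * swapOp K) * x * (swapOp K * swapOp K) := by simp only [mul_assoc]
    _ = _ := by rw [swapOp_mul_swapOp, one_mul, mul_one]

theorem swapFun_swapFun (x : LPA.zeroComponent K twoLoopGraph) : swapFun K (swapFun K x) = x :=
  zeroComponent_ext K (by rw [rep_swapFun, rep_swapFun, conj_conj])

/-- The automorphism of the degree zero component given by conjugation with `swapOp`. -/
noncomputable def swapAut :
    LPA.zeroComponent K twoLoopGraph ≃ₐ[K] LPA.zeroComponent K twoLoopGraph where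
  toFun := swapFun K
  invFun := swapFun K
  left_inv := swapFun_swapFun K
  right_inv := swapFun_swapFun K
  map_mul' x y := zeroComponent_ext K (by
    rw [rep_swapFun, MulMemClass.coe_mul, MulMemClass.coe_mul, map_mul, map_mul, rep_swapFun,
      rep_swapFun, conj_mul])
  map_add' x y := zeroComponent_ext K (by
    rw [rep_swapFun, AddMemClass.coe_add, AddMemClass.coe_add, map_add, map_add, rep_swapFun,
      rep_swapFun, mul_add, add_mul])
  commutes' c := zeroComponent_ext K (by
    rw [rep_swapFun, Subalgebra.coe_algebraMap, AlgHom.commutes, ← Algebra.commutes, mul_assoc,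
      swapOp_mul_swapOp, mul_one])

theorem rep_swapAut (x : LPA.zeroComponent K twoLoopGraph) :
    rep K (swapAut K x) = swapOp K * rep K x * swapOp K := rep_swapFun K x

/-- The operator permuting the first `2 * M` basis vectors by `swapPairs` and fixing the others. -/
noncomputable def truncOp (M : ℕ) : Module.End K (ℕ →₀ K) :=
  op K fun i => if i < 2 * M then bas K (swapPairs i) else bas K i

theorem truncOp_bas_of_lt {M i : ℕ} (h : i < 2 * M) :
    truncOp K M (bas K i) = bas K (swapPairs i) := by
  rw [truncOp, op_bas, if_pos h]

theorem truncOp_bas_of_not_lt {M i : ℕ} (h : ¬ i < 2 * M) :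
    truncOp K M (bas K i) = bas K i := by
  rw [truncOp, op_bas, if_neg h]

theorem truncOp_mul_truncOp (M : ℕ) : truncOp K M * truncOp K M = 1 :=
  end_ext fun i => by
    rw [Module.End.mul_apply, Module.End.one_apply]
    by_cases h : i < 2 * M
    · rw [truncOp_bas_of_lt K h, truncOp_bas_of_lt K (swapPairs_lt.2 h), swapPairs_swapPairs]
    · rw [truncOp_bas_of_not_lt K h, truncOp_bas_of_not_lt K h]

/-- The element of degree zero acting as `truncOp`. -/
noncomputable def truncElt (M : ℕ) : LPA.zeroComponent K twoLoopGraph :=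
  1 + ∑ i ∈ Finset.range (2 * M),
    (⟨eps K (swapPairs i) i, eps_mem K _ _⟩ - ⟨eps K i i, eps_mem K _ _⟩)

theorem rep_truncElt (M : ℕ) : rep K (truncElt K M : LPA K twoLoopGraph) = truncOp K M :=
  end_ext fun k => by
    rw [truncElt, AddMemClass.coe_add, AddSubmonoidClass.coe_finsetSum]
    simp only [OneMemClass.coe_one, AddSubgroupClass.coe_sub, map_add, map_one, map_sum, map_sub,
      LinearMap.add_apply, Module.End.one_apply, LinearMap.sum_apply, LinearMap.sub_apply, rep_eps]
    by_cases h : k < 2 * M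
    · rw [truncOp_bas_of_lt K h, Finset.sum_eq_single_of_mem k (Finset.mem_range.2 h)]
      · simp
      · intro i _ hi
        simp [hi.symm]
    · rw [truncOp_bas_of_not_lt K h, Finset.sum_eq_zero, add_zero]
      intro i hi
      have : k ≠ i := by rintro rfl; exact h (Finset.mem_range.1 hi)
      simp [this]

theorem truncElt_mul_truncElt (M : ℕ) : truncElt K M * truncElt K M = 1 :=
  zeroComponent_ext K (by
    rw [MulMemClass.coe_mul, map_mul, rep_truncElt, truncOp_mul_truncOp, OneMemClass.coe_one,
      map_one])

/-- Once 2M exceeds both indices of a matrix unit, the full and the truncated permutation act alike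
on the vectors it involves. Scalars are unaffected by either conjugation. -/
theorem exists_conj_eq_truncOp {x : LPA K twoLoopGraph}
    (hx : x ∈ LPA.zeroComponent K twoLoopGraph) :
    ∃ N, ∀ M ≥ N, swapOp K * rep K x * swapOp K = truncOp K M * rep K x * truncOp K M := by
  refine one_eps_induction K (P := fun x => ∃ N, ∀ M ≥ N,
    swapOp K * rep K x * swapOp K = truncOp K M * rep K x * truncOp K M) ?_ ?_ ?_ ?_ hx
  · exact ⟨0, fun M _ => by
      rw [map_one, mul_one, mul_one, swapOp_mul_swapOp, truncOp_mul_truncOp]⟩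
  · refine fun i j => ⟨i + j + 1, fun M hM => end_ext fun k => ?_⟩
    rw [← rep_eps_swapPairs, rep_eps, Module.End.mul_apply, Module.End.mul_apply]
    by_cases h : k < 2 * M
    · rw [truncOp_bas_of_lt K h, rep_eps]
      by_cases hk : k = swapPairs j
      · rw [if_pos hk, hk, swapPairs_swapPairs, if_pos rfl, truncOp_bas_of_lt K (by omega)]
      · rw [if_neg hk, if_neg, map_zero]
        rintro rfl
        exact hk (swapPairs_swapPairs k).symm
    · rw [truncOp_bas_of_not_lt K h, rep_eps, if_neg, if_neg, map_zero]
      · omega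
      · rintro rfl
        exact h (swapPairs_lt.2 (by omega))
  · rintro x y ⟨N, hN⟩ ⟨N', hN'⟩
    refine ⟨max N N', fun M hM => ?_⟩
    simp only [map_add, mul_add, add_mul]
    rw [hN M (le_of_max_le_left hM), hN' M (le_of_max_le_right hM)]
  · rintro c x ⟨N, hN⟩
    refine ⟨N, fun M hM => ?_⟩
    simp only [map_smul, mul_smul_comm, smul_mul_assoc]
    rw [hN M hM]

theorem isLocallyInner_swapAut : IsLocallyInner (swapAut K) := by
  intro S
  choose N hN using fun x : LPA.zeroComponent K twoLoopGraph => exists_conj_eq_truncOp K x.2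
  refine ⟨⟨truncElt K (S.sup N), truncElt K (S.sup N), truncElt_mul_truncElt K _,
    truncElt_mul_truncElt K _⟩, fun x hx => zeroComponent_ext K ?_⟩
  rw [rep_swapAut, hN x _ (Finset.le_sup hx)]
  simp only [Units.inv_mk, MulMemClass.coe_mul, map_mul, rep_truncElt]

end Automorphism

/-! ### The deformed algebra is not finitely generated -/

section Deformation

variable (K : Type w) [Field K]

/-- The deformation of the Leavitt path algebra of `twoLoopGraph` by `swapAut`. -/
abbrev Deformed : Type w := DeformedLPA twoLoopGraph twoLoopChoice twoLoopChoice_spec (swapAut K)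

/-- The corner map of the deformation. -/
noncomputable abbrev deformedCorner :
    LPA.zeroComponent K twoLoopGraph →ₙₐ[K] LPA.zeroComponent K twoLoopGraph :=
  ((swapAut K : LPA.zeroComponent K twoLoopGraph →ₙₐ[K] LPA.zeroComponent K twoLoopGraph).comp
    (LPA.cornerMap K twoLoopGraph twoLoopChoice twoLoopChoice_spec))

/-- The operator representing `s₊`. -/
noncomputable def plusOp : Module.End K (ℕ →₀ K) :=
  swapOp K * rep K (LPA.tPlus K twoLoopGraph twoLoopChoice)

/-- The operator representing `s₋`. -/
noncomputable def minusOp : Module.End K (ℕ →₀ K) :=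
  rep K (LPA.tMinus K twoLoopGraph twoLoopChoice) * swapOp K

theorem minusOp_mul_plusOp : minusOp K * plusOp K = 1 := by
  rw [minusOp, plusOp, mul_assoc, ← mul_assoc (swapOp K), swapOp_mul_swapOp, one_mul, ← map_mul,
    LPA.tMinus_mul_tPlus K twoLoopGraph twoLoopChoice_spec, map_one]

/-- Both g and α are conjugations on operators, so their composite is x ↦ s₊xs₋. With s₋s₊ = 1 this
yields every relation of the deformation. -/
theorem rep_deformedCorner (x : LPA.zeroComponent K twoLoopGraph) :
    rep K (deformedCorner K x) = plusOp K * rep K x * minusOp K := by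
  refine (rep_swapAut K _).trans ?_
  change swapOp K * rep K (LPA.tPlus K twoLoopGraph twoLoopChoice * x *
    LPA.tMinus K twoLoopGraph twoLoopChoice) * swapOp K = _
  simp only [map_mul, plusOp, minusOp, mul_assoc]

theorem plusOp_mul_rep (x : LPA.zeroComponent K twoLoopGraph) :
    plusOp K * rep K x = rep K (deformedCorner K x) * plusOp K := by
  rw [rep_deformedCorner, mul_assoc _ (minusOp K), minusOp_mul_plusOp, mul_one]

theorem rep_mul_minusOp (x : LPA.zeroComponent K twoLoopGraph) :
    rep K (x : LPA K twoLoopGraph) * minusOp K = minusOp K * rep K (deformedCorner K x) := by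
  rw [rep_deformedCorner, mul_assoc, ← mul_assoc, minusOp_mul_plusOp, one_mul]

theorem plusOp_pow_mul_rep (n : ℕ) (x : LPA.zeroComponent K twoLoopGraph) :
    plusOp K ^ n * rep K x = rep K ((deformedCorner K)^[n] x) * plusOp K ^ n := by
  induction n generalizing x with
  | zero => simp
  | succ n ih =>
    rw [Function.iterate_succ_apply, pow_succ, mul_assoc, plusOp_mul_rep, ← mul_assoc, ih,
      mul_assoc]

theorem rep_mul_minusOp_pow (n : ℕ) (x : LPA.zeroComponent K twoLoopGraph) :
    rep K (x : LPA K twoLoopGraph) * minusOp K ^ n =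
      minusOp K ^ n * rep K ((deformedCorner K)^[n] x) := by
  induction n generalizing x with
  | zero => simp
  | succ n ih =>
    rw [Function.iterate_succ_apply, pow_succ', ← mul_assoc, rep_mul_minusOp, mul_assoc, ih,
      mul_assoc]

/-- The operators representing the generators of the deformation. -/
noncomputable def skewOp :
    SkewGen (LPA.zeroComponent K twoLoopGraph) → Module.End K (ℕ →₀ K)
  | .of a => rep K a
  | .tPlus => plusOp K
  | .tMinus => minusOp K

theorem lift_skewOp_rel ⦃x y : FreeAlgebra K (SkewGen (LPA.zeroComponent K twoLoopGraph))⦄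
    (h : SkewRel K (deformedCorner K) x y) :
    FreeAlgebra.lift K (skewOp K) x = FreeAlgebra.lift K (skewOp K) y := by
  cases h with
  | of_add a b => simp [skewOp]
  | of_mul a b => simp [skewOp]
  | of_smul k a => simp [skewOp]
  | of_zero => simp [skewOp]
  | of_one => simp [skewOp]
  | tMinus_tPlus =>
    simp only [map_mul, FreeAlgebra.lift_ι_apply, skewOp, map_one]
    exact minusOp_mul_plusOp K
  | tPlus_tMinus =>
    simp only [map_mul, FreeAlgebra.lift_ι_apply, skewOp]
    rw [rep_deformedCorner, OneMemClass.coe_one, map_one, mul_one]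
  | tPlus_of n a =>
    simp only [map_mul, map_pow, FreeAlgebra.lift_ι_apply, skewOp]
    exact plusOp_pow_mul_rep K n a
  | of_tMinus n a =>
    simp only [map_mul, map_pow, FreeAlgebra.lift_ι_apply, skewOp]
    exact rep_mul_minusOp_pow K n a

/-- The representation of the deformation on `ℕ →₀ K`. -/
noncomputable def deformedRep : Deformed K →ₐ[K] Module.End K (ℕ →₀ K) :=
  RingQuot.liftAlgHom K ⟨FreeAlgebra.lift K (skewOp K), lift_skewOp_rel K⟩

theorem deformedRep_mk (x : SkewGen (LPA.zeroComponent K twoLoopGraph)) :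
    deformedRep K (RingQuot.mkAlgHom K (SkewRel K (deformedCorner K)) (FreeAlgebra.ι K x)) =
      skewOp K x := by
  rw [deformedRep, RingQuot.liftAlgHom_mkAlgHom_apply, FreeAlgebra.lift_ι_apply]

/-- The shift takes 2i to its partner 2i + 1, and the permutation brings it back. -/
theorem plusOp_bas_even {i : ℕ} (h : i ≠ 0) : plusOp K (bas K (2 * i)) = bas K (2 * i) := by
  rw [plusOp, tPlus_eq, Module.End.mul_apply, map_add, LinearMap.add_apply, rep_ed, rep_gd,
    if_neg (by omega), if_neg (by omega), add_zero, swapOp_bas]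
  congr 1
  unfold swapPairs
  rw [if_neg (by omega), if_neg (by omega), Nat.add_sub_cancel]

theorem minusOp_bas_even {i : ℕ} (h : i ≠ 0) : minusOp K (bas K (2 * i)) = bas K (2 * i) := by
  conv_lhs => rw [← plusOp_bas_even K h]
  rw [← Module.End.mul_apply, minusOp_mul_plusOp, Module.End.one_apply]

/-- The elements of the deformation having all basis vectors `2 * i` with `i ≥ N` as
eigenvectors. -/
def eigenSubalgebra (N : ℕ) : Subalgebra K (Deformed K) where
  carrier := {x | ∀ i ≥ N, ∃ c : K, deformedRep K x (bas K (2 * i)) = c • bas K (2 * i)}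
  mul_mem' := by
    intro x y hx hy i hi
    obtain ⟨c, hc⟩ := hx i hi
    obtain ⟨d, hd⟩ := hy i hi
    exact ⟨d * c, by rw [map_mul, Module.End.mul_apply, hd, map_smul, hc, smul_smul]⟩
  add_mem' := by
    intro x y hx hy i hi
    obtain ⟨c, hc⟩ := hx i hi
    obtain ⟨d, hd⟩ := hy i hi
    exact ⟨c + d, by rw [map_add, LinearMap.add_apply, hc, hd, add_smul]⟩
  algebraMap_mem' k i _ := ⟨k, by rw [AlgHom.commutes, Module.algebraMap_end_apply]⟩

theorem eigenSubalgebra_mono : Monotone (eigenSubalgebra K) :=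
  fun _ _ h _ hx i hi => hx i (h.trans hi)

/-- A finitary matrix kills b_i for large i, so only the scalar part acts there. -/
theorem exists_rep_bas_eq_smul {x : LPA K twoLoopGraph}
    (hx : x ∈ LPA.zeroComponent K twoLoopGraph) :
    ∃ N, ∀ i ≥ N, ∃ c : K, rep K x (bas K i) = c • bas K i := by
  refine one_eps_induction K (P := fun x => ∃ N, ∀ i ≥ N, ∃ c : K,
    rep K x (bas K i) = c • bas K i) ?_ ?_ ?_ ?_ hx
  · exact ⟨0, fun i _ => ⟨1, by rw [map_one, one_smul, Module.End.one_apply]⟩⟩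
  · exact fun k l => ⟨l + 1, fun i hi => ⟨0, by rw [rep_eps, if_neg (by omega), zero_smul]⟩⟩
  · rintro x y ⟨N, hN⟩ ⟨N', hN'⟩
    refine ⟨max N N', fun i hi => ?_⟩
    obtain ⟨c, hc⟩ := hN i (le_of_max_le_left hi)
    obtain ⟨d, hd⟩ := hN' i (le_of_max_le_right hi)
    exact ⟨c + d, by rw [map_add, LinearMap.add_apply, hc, hd, add_smul]⟩
  · rintro a x ⟨N, hN⟩
    refine ⟨N, fun i hi => ?_⟩
    obtain ⟨c, hc⟩ := hN i hi
    exact ⟨a * c, by rw [map_smul, LinearMap.smul_apply, hc, smul_smul]⟩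

/-- The subalgebras increase with N, so their union is closed under sums and products, and it
suffices to place the generators. For s₊ and s₋ the bound is 1, with eigenvalue 1. -/
theorem exists_mem_eigenSubalgebra (x : Deformed K) : ∃ N, x ∈ eigenSubalgebra K N := by
  obtain ⟨x, rfl⟩ := RingQuot.mkAlgHom_surjective K (SkewRel K (deformedCorner K)) x
  induction x using FreeAlgebra.induction with
  | grade0 r => exact ⟨0, by rw [AlgHom.commutes]; exact Subalgebra.algebraMap_mem _ r⟩
  | grade1 g =>
    rcases g with a | _ | _
    · obtain ⟨N, hN⟩ := exists_rep_bas_eq_smul K a.2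
      refine ⟨N, fun i hi => ?_⟩
      rw [deformedRep_mk]
      exact hN _ (by omega)
    · refine ⟨1, fun i hi => ⟨1, ?_⟩⟩
      rw [deformedRep_mk, one_smul]
      exact plusOp_bas_even K (by omega)
    · refine ⟨1, fun i hi => ⟨1, ?_⟩⟩
      rw [deformedRep_mk, one_smul]
      exact minusOp_bas_even K (by omega)
  | mul a b ha hb =>
    obtain ⟨N, hN⟩ := ha
    obtain ⟨N', hN'⟩ := hb
    refine ⟨max N N', ?_⟩
    rw [map_mul]
    exact mul_mem (eigenSubalgebra_mono K (le_max_left _ _) hN)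
      (eigenSubalgebra_mono K (le_max_right _ _) hN')
  | add a b ha hb =>
    obtain ⟨N, hN⟩ := ha
    obtain ⟨N', hN'⟩ := hb
    refine ⟨max N N', ?_⟩
    rw [map_add]
    exact add_mem (eigenSubalgebra_mono K (le_max_left _ _) hN)
      (eigenSubalgebra_mono K (le_max_right _ _) hN')

theorem eigenSubalgebra_ne_top (N : ℕ) : eigenSubalgebra K N ≠ ⊤ := by
  intro h
  have hmem : RingQuot.mkAlgHom K (SkewRel K (deformedCorner K)) (FreeAlgebra.ι K
      (.of ⟨eps K (2 * N + 1) (2 * N), eps_mem K _ _⟩)) ∈ eigenSubalgebra K N := by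
    rw [h]; exact Algebra.mem_top
  obtain ⟨c, hc⟩ := hmem N le_rfl
  rw [deformedRep_mk, skewOp, rep_eps, if_pos rfl] at hc
  -- The matrix unit sends b_{2N} to b_{2N+1}; at coordinate 2N + 1 the eigenvector equation would
  -- read 1 = 0.
  have := DFunLike.congr_fun hc (2 * N + 1)
  simp at this

/-- An algebra that is the union of an increasing sequence of proper subalgebras is not finitely
generated: a finite generating set would lie in one of them. -/
theorem not_finiteType_deformed : ¬ Algebra.FiniteType K (Deformed K) := by
  rintro ⟨S, hS⟩
  choose N hN using exists_mem_eigenSubalgebra K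
  refine eigenSubalgebra_ne_top K (S.sup N) (top_le_iff.1 ?_)
  rw [← hS]
  exact Algebra.adjoin_le fun x hx => eigenSubalgebra_mono K (Finset.le_sup hx) (hN x)

end Deformation

end TwoLoop

theorem mainTheorem8 (K : Type w) [Field K] [Infinite K] :
    ∃ g : DirectedGraph.LPA.zeroComponent K twoLoopGraph ≃ₐ[K]
        DirectedGraph.LPA.zeroComponent K twoLoopGraph,
      IsLocallyInner g ∧
      ¬ Algebra.FiniteType K
          (DirectedGraph.DeformedLPA twoLoopGraph twoLoopChoice twoLoopChoice_spec g) ∧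
      ∀ (F : DirectedGraph.{u, v}) [Fintype F.E0] [Fintype F.E1],
        IsEmpty (DirectedGraph.DeformedLPA twoLoopGraph twoLoopChoice twoLoopChoice_spec g ≃ₐ[K]
          DirectedGraph.LPA K F) := by
  refine ⟨TwoLoop.swapAut K, TwoLoop.isLocallyInner_swapAut K, TwoLoop.not_finiteType_deformed K,
    fun F _ _ => ⟨fun φ => TwoLoop.not_finiteType_deformed K ?_⟩⟩
  exact (DirectedGraph.LPA.finiteType K F).equiv φ.symm
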